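/- Let $n\ge 0$ be an integer, $p\in[1,\infty)$, let $M$ be a (smooth, second countable, boundaryless, not necessarily connected) Riemannian $n$-manifold with its Riemannian distance, and let $E\subset M$ be a closed set. Let $\mathcal H^n$ be the $n$-dimensional Hausdorff measure on $M$, normalized so that it is the Riemannian volume. For an open set $\Omega\subset M$ and a metric space $X$, let $W^{1,p}(\Omega,X)$ be the set of $\mathcal H^n$-a.e. classes of strongly measurable maps $u\colon\Omega\to X$ such that $\int_\Omega d(u,x_0)^p\,d\mathcal H^n<\infty$ for some $x_0\in X$ and such that some representative $\tilde u$ of $u$ has an upper gradient $g$ with $\int_\Omega g^p\,d\mathcal H^n<\infty$; here a Borel function $g\colon\Omega\to[0,\infty]$ is an upper gradient of $\tilde u$ if $d(\tilde u(\gamma(a)),\tilde u(\gamma(b)))\le\int_\gamma g\,ds$ for every rectifiable curve $\gamma\colon[a,b]\to\Omega$. Let $W^{1,p}(\Omega)$ be the set of those $u$ as above for $X=\mathbb R$ for which $x_0=0$ is admissible. We say that $E$ is removable for $W^{1,p}$-functions if $\mathcal H^n(E)=0$ and every $u\in W^{1,p}(M\setminus E)$ is the restriction of some $h\in W^{1,p}(M)$.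 We say that $E$ is removable for $W^{1,p}$-mappings if $\mathcal H^n(E)=0$ and, for every complete metric space $X$, every $u\in W^{1,p}(M\setminus E,X)$ is the restriction of some $h\in W^{1,p}(M,X)$. Then $E$ is removable for $W^{1,p}$-functions if and only if $E$ is removable for $W^{1,p}$-mappings. -/

import Mathlib

open MeasureTheory Set Bundle
open scoped ENNReal Manifold ContDiff

universe u v

/-- A Borel function `g : Y → [0, ∞]` is an *upper gradient* of `f : Y → X` if
`d (f (γ a), f (γ b)) ≤ ∫_γ g ds` for every rectifiable curve `γ` in `Y` with endpoints
`γ a`, `γ b`. Both sides only depend on the arc length parametrization of the curve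
(by definition, `∫_γ g ds` is the integral of `g` along that parametrization), so the curves are
taken as given by it: `γ` is defined on `[0, L]` and the length of `γ` on every subinterval of
`[0, L]` equals the length of the subinterval. -/
def IsUpperGradient {Y : Type*} [EMetricSpace Y] [MeasurableSpace Y]
    {X : Type*} [MetricSpace X] (f : Y → X) (g : Y → ℝ≥0∞) : Prop :=
  Measurable g ∧
    ∀ (L : ℝ) (γ : ℝ → Y), 0 ≤ L → HasUnitSpeedOn γ (Icc 0 L) →
      edist (f (γ 0)) (f (γ L)) ≤ ∫⁻ t in Icc 0 L, g (γ t)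

/-- The Sobolev condition with respect to a base point `x₀` of the target: `f` is (strongly)
measurable, `d (f, x₀)` is `p`-integrable, and a representative of `f` (a map that is a.e. equal
to `f`) has a `p`-integrable upper gradient. -/
def MemSobolevBased {Y : Type*} [EMetricSpace Y] [MeasurableSpace Y]
    {X : Type*} [MetricSpace X] (μ : Measure Y) (p : ℝ) (x₀ : X) (f : Y → X) : Prop :=
  AEStronglyMeasurable f μ ∧
    ∫⁻ y, edist (f y) x₀ ^ p ∂μ < ⊤ ∧
    ∃ f' : Y → X, f' =ᵐ[μ] f ∧
      ∃ g : Y → ℝ≥0∞, IsUpperGradient f' g ∧ ∫⁻ y, g y ^ p ∂μ < ⊤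

/-- Representatives of elements of `W^{1,p}(Y)`, the real valued Sobolev functions on the metric
measure space `(Y, μ)`. -/
def MemSobolevFun {Y : Type*} [EMetricSpace Y] [MeasurableSpace Y]
    (μ : Measure Y) (p : ℝ) (f : Y → ℝ) : Prop :=
  MemSobolevBased μ p 0 f

/-- Representatives of elements of `W^{1,p}(Y, X)`, the Sobolev mappings from the metric measure
space `(Y, μ)` into the metric space `X`. The `p`-integrability of the mapping is understood with
respect to some base point of `X`. -/
def MemSobolevMap {Y : Type*} [EMetricSpace Y] [MeasurableSpace Y]
    {X : Type*} [MetricSpace X] (μ : Measure Y) (p : ℝ) (f : Y → X) : Prop :=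
  ∃ x₀ : X, MemSobolevBased μ p x₀ f

/-- The Riemannian volume on the complement of `E` in a Riemannian `n`-manifold `M`: the
`n`-dimensional Hausdorff measure, normalized to agree with the Lebesgue measure on Euclidean
`n`-space, restricted to the complement. (Lengths of curves in the complement are computed by the
distance of `M`; they agree with the lengths in the Riemannian manifold `M \ E`.) -/
noncomputable def volCompl {M : Type*} [EMetricSpace M] [MeasurableSpace M] [BorelSpace M]
    (n : ℕ) (E : Set M) : Measure (Eᶜ : Set M) :=
  (Measure.euclideanHausdorffMeasure n : Measure M).comap Subtype.val

/-- `E` is removable for `W^{1,p}`-functions: `E` has zero volume and every element of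
`W^{1,p}(M \ E)` is the restriction of an element of `W^{1,p}(M)`. -/
def IsRemovableForFunctions {M : Type*} [EMetricSpace M] [MeasurableSpace M] [BorelSpace M]
    (n : ℕ) (p : ℝ) (E : Set M) : Prop :=
  (Measure.euclideanHausdorffMeasure n : Measure M) E = 0 ∧
    ∀ f : (Eᶜ : Set M) → ℝ, MemSobolevFun (volCompl n E) p f →
      ∃ h : M → ℝ, MemSobolevFun (Measure.euclideanHausdorffMeasure n) p h ∧
        ∀ x : (Eᶜ : Set M), h x = f x

/-- `E` is removable for `W^{1,p}`-mappings: `E` has zero volume and, for every complete metric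
space `X`, every element of `W^{1,p}(M \ E, X)` is the restriction of an element of
`W^{1,p}(M, X)`. -/
def IsRemovableForMappings {M : Type u} [EMetricSpace M] [MeasurableSpace M] [BorelSpace M]
    (n : ℕ) (p : ℝ) (E : Set M) : Prop :=
  (Measure.euclideanHausdorffMeasure n : Measure M) E = 0 ∧
    ∀ (X : Type v) [MetricSpace X] [CompleteSpace X] (f : (Eᶜ : Set M) → X),
      MemSobolevMap (volCompl n E) p f →
        ∃ h : M → X, MemSobolevMap (Measure.euclideanHausdorffMeasure n) p h ∧
          ∀ x : (Eᶜ : Set M), h x = f x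

section UnitSpeed

variable {Y : Type*} [PseudoEMetricSpace Y] {γ : ℝ → Y} {a b : ℝ}

theorem hasUnitSpeedOn_Icc_iff :
    HasUnitSpeedOn γ (Icc a b) ↔
      ∀ s t, a ≤ s → s ≤ t → t ≤ b → eVariationOn γ (Icc s t) = ENNReal.ofReal (t - s) := by
  rw [HasUnitSpeedOn, hasConstantSpeedOnWith_iff_ordered]
  have key : ∀ s t, a ≤ s → t ≤ b → Icc a b ∩ Icc s t = Icc s t := fun s t hs ht =>
    inter_eq_right.2 (Icc_subset_Icc hs ht)
  constructor
  · intro h s t hs hst ht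
    have := h (x := s) ⟨hs, hst.trans ht⟩ (y := t) ⟨hs.trans hst, ht⟩ hst
    rwa [key s t hs ht, NNReal.coe_one, one_mul] at this
  · intro h s hs t ht hst
    rw [key s t hs.1 ht.2, NNReal.coe_one, one_mul]
    exact h s t hs.1 hst ht.2

theorem HasUnitSpeedOn.comp_const_add (h : HasUnitSpeedOn γ (Icc a b)) :
    HasUnitSpeedOn (fun t => γ (a + t)) (Icc 0 (b - a)) := by
  rw [hasUnitSpeedOn_Icc_iff] at h ⊢
  intro s t hs hst ht
  have h1 := eVariationOn.comp_eq_of_monotoneOn γ (t := Icc s t) (fun r => a + r)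
    (fun x _ y _ hxy => by simpa using hxy)
  rw [Set.image_const_add_Icc] at h1
  have h2 := h (a + s) (a + t) (by linarith) (by linarith) (by linarith)
  rw [← h1] at h2
  rw [show t - s = a + t - (a + s) by ring]
  exact h2

theorem HasUnitSpeedOn.mono_Icc {c d : ℝ} (h : HasUnitSpeedOn γ (Icc a b)) (hac : a ≤ c)
    (hdb : d ≤ b) : HasUnitSpeedOn γ (Icc c d) := by
  rw [hasUnitSpeedOn_Icc_iff] at h ⊢
  exact fun s t hs hst ht => h s t (hac.trans hs) hst (ht.trans hdb)

theorem HasUnitSpeedOn.edist_le (h : HasUnitSpeedOn γ (Icc a b)) {s t : ℝ} (hs : s ∈ Icc a b)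
    (ht : t ∈ Icc a b) : edist (γ s) (γ t) ≤ edist s t := by
  wlog hst : s ≤ t generalizing s t
  · rw [edist_comm, edist_comm s]
    exact this ht hs (le_of_not_ge hst)
  rw [hasUnitSpeedOn_Icc_iff] at h
  rw [edist_comm s, edist_dist, Real.dist_eq, abs_of_nonneg (sub_nonneg.2 hst),
    ← h s t hs.1 hst ht.2]
  exact eVariationOn.edist_le _ (left_mem_Icc.2 hst) (right_mem_Icc.2 hst)

theorem HasUnitSpeedOn.continuousOn (h : HasUnitSpeedOn γ (Icc a b)) :
    ContinuousOn γ (Icc a b) := by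
  have : LipschitzOnWith 1 γ (Icc a b) := fun s hs t ht => by
    simpa using h.edist_le hs ht
  exact this.continuousOn

theorem HasUnitSpeedOn.of_eqOn_coe {S : Set Y} {σ : ℝ → S} (h : HasUnitSpeedOn γ (Icc a b))
    (hσ : EqOn (fun t => (σ t : Y)) γ (Icc a b)) : HasUnitSpeedOn σ (Icc a b) := by
  rw [hasUnitSpeedOn_Icc_iff] at h ⊢
  intro s t hs hst ht
  rw [← h s t hs hst ht, ← eVariationOn.eq_of_eqOn (hσ.mono (Icc_subset_Icc hs ht))]
  rfl

end UnitSpeed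

section UpperGradient

variable {Y : Type*} [EMetricSpace Y] [MeasurableSpace Y] {X : Type*} [MetricSpace X]

theorem IsUpperGradient.edist_le_setLIntegral {f : Y → X} {g : Y → ℝ≥0∞}
    (h : IsUpperGradient f g) {γ : ℝ → Y} {a b : ℝ} (hab : a ≤ b)
    (hγ : HasUnitSpeedOn γ (Icc a b)) :
    edist (f (γ a)) (f (γ b)) ≤ ∫⁻ t in Icc a b, g (γ t) := by
  have h1 := h.2 (b - a) _ (sub_nonneg.2 hab) hγ.comp_const_add
  have h2 := (measurePreserving_add_left volume a).setLIntegral_comp_emb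
    (MeasurableEquiv.addLeft a).measurableEmbedding (fun t => g (γ t)) (Icc 0 (b - a))
  rw [Set.image_const_add_Icc] at h2
  simp only [add_zero, add_sub_cancel] at h1 h2
  exact h1.trans h2.le

theorem IsUpperGradient.edist_le_setLIntegral_extend {S : Set Y} {f : S → X} {g : S → ℝ≥0∞}
    (h : IsUpperGradient f g) {γ : ℝ → Y} {a b : ℝ} (hab : a ≤ b)
    (hγ : HasUnitSpeedOn γ (Icc a b)) (hS : ∀ t ∈ Icc a b, γ t ∈ S) {x y : S}
    (hx : (x : Y) = γ a) (hy : (y : Y) = γ b) (g₀ : Y → ℝ≥0∞) :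
    edist (f x) (f y) ≤ ∫⁻ t in Icc a b, Function.extend Subtype.val g g₀ (γ t) := by
  let σ : ℝ → S := fun t => ⟨γ (projIcc a b hab t), hS _ (projIcc a b hab t).2⟩
  have hσ : ∀ t ∈ Icc a b, (σ t : Y) = γ t := fun t ht => by
    simp only [σ, projIcc_of_mem hab ht]
  have h1 := h.edist_le_setLIntegral hab (hγ.of_eqOn_coe hσ)
  rw [show x = σ a from Subtype.ext (hx.trans (hσ a (left_mem_Icc.2 hab)).symm),
    show y = σ b from Subtype.ext (hy.trans (hσ b (right_mem_Icc.2 hab)).symm)]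
  refine h1.trans (setLIntegral_mono' measurableSet_Icc fun t ht => ?_)
  rw [← hσ t ht, Subtype.val_injective.extend_apply]

end UpperGradient

section Interval

variable {X : Type*} [MetricSpace X] {φ : ℝ → X} {k g : ℝ → ℝ≥0∞} {a b : ℝ}

theorem exists_pos_forall_edist_lt
    (hk : ∀ s t, a ≤ s → s ≤ t → t ≤ b → edist (φ s) (φ t) ≤ ∫⁻ r in Icc s t, k r)
    (hfin : ∫⁻ r in Icc a b, k r ≠ ⊤) {ε : ℝ≥0∞} (hε : ε ≠ 0) :
    ∃ δ > 0, ∀ s t, a ≤ s → s ≤ t → t ≤ b → t - s < δ → edist (φ s) (φ t) < ε := by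
  obtain ⟨δ, hδ, H⟩ := exists_pos_setLIntegral_lt_of_measure_lt hfin hε
  obtain ⟨η, hη, hηδ⟩ := ENNReal.lt_iff_exists_real_btwn.1 hδ
  have hη0 : 0 < η := ENNReal.ofReal_pos.1 hηδ.1
  refine ⟨η, hη0, fun s t hs hst ht hlt => (hk s t hs hst ht).trans_lt ?_⟩
  have := H (Icc s t) <| by
    rw [Measure.restrict_apply measurableSet_Icc,
      inter_eq_left.2 (Icc_subset_Icc hs ht), Real.volume_Icc]
    exact (ENNReal.ofReal_le_ofReal hlt.le).trans_lt hηδ.2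
  rwa [Measure.restrict_restrict measurableSet_Icc, inter_eq_left.2 (Icc_subset_Icc hs ht)] at this

theorem continuousOn_of_edist_le_setLIntegral
    (hk : ∀ s t, a ≤ s → s ≤ t → t ≤ b → edist (φ s) (φ t) ≤ ∫⁻ r in Icc s t, k r)
    (hfin : ∫⁻ r in Icc a b, k r ≠ ⊤) : ContinuousOn φ (Icc a b) := by
  refine EMetric.continuousOn_iff.2 fun s hs ε hε => ?_
  obtain ⟨δ, hδ, H⟩ := exists_pos_forall_edist_lt hk hfin hε.ne'
  refine ⟨ENNReal.ofReal δ, ENNReal.ofReal_pos.2 hδ, fun t ht hts => ?_⟩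
  rw [edist_lt_ofReal, Real.dist_eq, abs_lt] at hts
  rcases le_total s t with h | h
  · rw [edist_comm]
    exact H s t hs.1 h ht.2 (by linarith)
  · exact H t s ht.1 h hs.2 (by linarith)

theorem exists_mem_Ioo_of_ae {P : ℝ → Prop} (hP : ∀ᵐ t ∂volume.restrict (Icc a b), P t) {s t : ℝ}
    (hs : a ≤ s) (hst : s < t) (ht : t ≤ b) : ∃ r ∈ Ioo s t, P r := by
  have h1 : ∀ᵐ r ∂volume.restrict (Ioo s t), P r :=
    ae_mono (Measure.restrict_mono (Ioo_subset_Icc_self.trans (Icc_subset_Icc hs ht)) le_rfl) hP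
  rw [ae_restrict_iff' measurableSet_Ioo] at h1
  by_contra! hcon
  have : volume (Ioo s t) = 0 := by
    refine measure_mono_null (fun r hr => ?_) (ae_iff.1 h1)
    exact fun hr' => hcon r hr (hr' hr)
  rw [Real.volume_Ioo, ENNReal.ofReal_eq_zero] at this
  linarith

/-- A bound on the oscillation by an integral extends from almost every pair of parameters
to all parameters by continuity. -/
theorem edist_le_setLIntegral_of_ae {P : ℝ → Prop} (hφ : ContinuousOn φ (Icc a b))
    (hP : ∀ᵐ t ∂volume.restrict (Icc a b), P t)
    (hg : ∀ s t, a ≤ s → s ≤ t → t ≤ b → P s → P t →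
      edist (φ s) (φ t) ≤ ∫⁻ r in Icc s t, g r) (hab : a ≤ b) :
    edist (φ a) (φ b) ≤ ∫⁻ r in Icc a b, g r := by
  rcases hab.eq_or_lt with rfl | hab'
  · simp
  refine ENNReal.le_of_forall_pos_le_add fun ε hε _ => ?_
  have hε2 : (0 : ℝ≥0∞) < ε / 2 := ENNReal.half_pos (by simpa using hε.ne')
  obtain ⟨δ, hδ, ha⟩ := EMetric.continuousOn_iff.1 hφ a (left_mem_Icc.2 hab) _ hε2
  obtain ⟨δ', hδ', hb⟩ := EMetric.continuousOn_iff.1 hφ b (right_mem_Icc.2 hab) _ hε2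
  obtain ⟨η, -, hη⟩ := ENNReal.lt_iff_exists_real_btwn.1 (lt_min hδ hδ')
  have hη0 : 0 < η := ENNReal.ofReal_pos.1 hη.1
  obtain ⟨s, hs, hPs⟩ := exists_mem_Ioo_of_ae hP (s := a) (t := min (a + η) ((a + b) / 2)) le_rfl
    (lt_min (by linarith) (by linarith)) ((min_le_right _ _).trans (by linarith))
  obtain ⟨t, ht, hPt⟩ := exists_mem_Ioo_of_ae hP (s := max (b - η) ((a + b) / 2)) (t := b)
    (le_max_of_le_right (by linarith)) (max_lt (by linarith) (by linarith)) le_rfl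
  rw [mem_Ioo, lt_min_iff] at hs
  rw [mem_Ioo, max_lt_iff] at ht
  have hsI : s ∈ Icc a b := ⟨hs.1.le, by linarith⟩
  have htI : t ∈ Icc a b := ⟨by linarith, ht.2.le⟩
  have h1 := ha s hsI <| by
    refine lt_of_lt_of_le ?_ (hη.2.le.trans (min_le_left _ _))
    rw [edist_lt_ofReal, Real.dist_eq, abs_lt]
    constructor <;> linarith
  have h2 := hb t htI <| by
    refine lt_of_lt_of_le ?_ (hη.2.le.trans (min_le_right _ _))
    rw [edist_lt_ofReal, Real.dist_eq, abs_lt]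
    constructor <;> linarith
  have h3 := hg s t hsI.1 (by linarith) htI.2 hPs hPt
  have h4 : ∫⁻ r in Icc s t, g r ≤ ∫⁻ r in Icc a b, g r :=
    lintegral_mono_set (Icc_subset_Icc hsI.1 htI.2)
  rw [edist_comm] at h1
  calc edist (φ a) (φ b) ≤ edist (φ a) (φ s) + edist (φ s) (φ t) + edist (φ t) (φ b) :=
        edist_triangle4 _ _ _ _
    _ ≤ ε / 2 + (∫⁻ r in Icc a b, g r) + ε / 2 := by
        gcongr
        exact h3.trans h4
    _ = (∫⁻ r in Icc a b, g r) + ε := by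
        rw [add_comm (ε / 2 : ℝ≥0∞), add_assoc, ENNReal.add_halves]

/-- Integral bounds for the oscillation that hold locally hold globally. -/
theorem edist_le_setLIntegral_of_cover {ι : Type*} {c : ι → Set (Icc a b)}
    (hc : ∀ i, IsOpen (c i)) (hcov : univ ⊆ ⋃ i, c i)
    (hg : ∀ i s t, s ≤ t → Icc s t ⊆ c i →
      edist (φ s) (φ t) ≤ ∫⁻ r in Icc (s : ℝ) t, g r) (hab : a ≤ b) :
    edist (φ a) (φ b) ≤ ∫⁻ r in Icc a b, g r := by
  obtain ⟨t, ht0, hmono, ⟨m, hm⟩, hsub⟩ := exists_monotone_Icc_subset_open_cover_Icc hab hc hcov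
  have key : ∀ j, edist (φ a) (φ (t j)) ≤ ∫⁻ r in Icc a (t j : ℝ), g r := by
    intro j
    induction j with
    | zero => simp [ht0]
    | succ j ih =>
      obtain ⟨i, hi⟩ := hsub j
      have h1 := hg i (t j) (t (j + 1)) (hmono j.le_succ) hi
      have hle : (t j : ℝ) ≤ t (j + 1) := hmono j.le_succ
      have h2 : ∫⁻ r in Icc a (t (j + 1) : ℝ), g r =
          (∫⁻ r in Icc a (t j : ℝ), g r) + ∫⁻ r in Icc (t j : ℝ) (t (j + 1)), g r := by
        rw [← Icc_union_Ioc_eq_Icc (t j).2.1 hle,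
          lintegral_union measurableSet_Ioc, setLIntegral_congr Ioc_ae_eq_Icc]
        exact disjoint_left.2 fun x hx hx' => not_lt.2 hx.2 hx'.1
      rw [h2]
      exact (edist_triangle _ _ _).trans (add_le_add ih h1)
  simpa [hm m le_rfl] using key m

/-- If the oscillation of `φ` is controlled by an integrable function everywhere and by `g` away
from a closed null set, then it is controlled by `g` everywhere. -/
theorem edist_le_setLIntegral_of_open {U : Set (Icc a b)} (hU : IsOpen U)
    (hgm : AEMeasurable g (volume.restrict (Icc a b)))
    (hU0 : volume (Subtype.val '' Uᶜ) = 0)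
    (hk : ∀ s t, a ≤ s → s ≤ t → t ≤ b → edist (φ s) (φ t) ≤ ∫⁻ r in Icc s t, k r)
    (hfin : ∫⁻ r in Icc a b, k r ≠ ⊤)
    (hg : ∀ s t : Icc a b, s ≤ t → Icc s t ⊆ U →
      edist (φ s) (φ t) ≤ ∫⁻ r in Icc (s : ℝ) t, g r) (hab : a ≤ b) :
    edist (φ a) (φ b) ≤ ∫⁻ r in Icc a b, g r := by
  refine ENNReal.le_of_forall_pos_le_add fun ε hε _ => ?_
  obtain ⟨δ, hδ, H⟩ := exists_pos_setLIntegral_lt_of_measure_lt hfin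
    (ε := (ε : ℝ≥0∞)) (by simpa using hε.ne')
  obtain ⟨V, hVsub, hVo, hV⟩ := (Subtype.val '' Uᶜ).exists_isOpen_lt_of_lt δ
    (hU0.trans_lt hδ)
  have hVk : ∫⁻ r in Icc a b, V.indicator k r ≤ ε := by
    rw [setLIntegral_indicator hVo.measurableSet]
    have := H V ((Measure.restrict_apply_le _ _).trans_lt hV)
    rw [Measure.restrict_restrict hVo.measurableSet] at this
    exact this.le
  have main : edist (φ a) (φ b) ≤ ∫⁻ r in Icc a b, (g r + V.indicator k r) := by
    refine edist_le_setLIntegral_of_cover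
      (c := fun i : Bool => if i then U else Subtype.val ⁻¹' V) ?_ ?_ ?_ hab
    · rintro (_ | _)
      · simpa using hVo.preimage continuous_subtype_val
      · simpa using hU
    · intro t _
      by_cases ht : t ∈ U
      · exact mem_iUnion.2 ⟨true, by simpa using ht⟩
      · exact mem_iUnion.2 ⟨false, by simpa using hVsub (mem_image_of_mem _ ht)⟩
    · rintro (_ | _) s t hst hsub
      · refine (hk s t s.2.1 hst t.2.2).trans
          (setLIntegral_mono' measurableSet_Icc fun r hr => ?_)
        have hrV : r ∈ V := by
          have := hsub (show (⟨r, s.2.1.trans hr.1, hr.2.trans t.2.2⟩ : Icc a b) ∈ Icc s t from hr)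
          simpa using this
        rw [indicator_of_mem hrV]
        exact le_add_self
      · exact (hg s t hst (by simpa using hsub)).trans (lintegral_mono fun r => le_self_add)
  rw [lintegral_add_left' hgm] at main
  exact main.trans (by gcongr)

end Interval

section Dominating

variable {Y : Type*} [MeasurableSpace Y] {μ : Measure Y} {p : ℝ}

/-- Countably many functions with finite `p`-energy are dominated, up to finite constants, by a
single such function. -/
theorem exists_dominating_of_lintegral_rpow_lt_top (hp : 0 < p) {G : ℕ → Y → ℝ≥0∞}
    (hG : ∀ i, Measurable (G i)) (hGp : ∀ i, ∫⁻ y, G i y ^ p ∂μ < ⊤) :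
    ∃ ρ : Y → ℝ≥0∞, Measurable ρ ∧ ∫⁻ y, ρ y ^ p ∂μ < ⊤ ∧
      ∀ i, ∃ C : ℝ≥0∞, C ≠ ⊤ ∧ ∀ y, G i y ≤ C * ρ y := by
  obtain ⟨c, hc0, hc⟩ := ENNReal.exists_pos_tsum_mul_lt_of_countable one_ne_zero
    (fun i => ∫⁻ y, G i y ^ p ∂μ) (fun i => (hGp i).ne)
  have hm : ∀ i, Measurable fun y => (c i : ℝ≥0∞) * G i y ^ p := fun i =>
    ((hG i).pow_const p).const_mul _
  refine ⟨fun y => (∑' i, (c i : ℝ≥0∞) * G i y ^ p) ^ p⁻¹,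
    (Measurable.tsum hm).pow_const _, ?_, fun i => ⟨(c i : ℝ≥0∞)⁻¹ ^ p⁻¹, ?_, fun y => ?_⟩⟩
  · simp_rw [ENNReal.rpow_inv_rpow hp.ne']
    rw [lintegral_tsum fun i => (hm i).aemeasurable]
    simp_rw [lintegral_const_mul _ ((hG _).pow_const p)]
    simp_rw [mul_comm (c _ : ℝ≥0∞)]
    exact hc.trans ENNReal.one_lt_top
  · exact ENNReal.rpow_ne_top_of_nonneg (inv_nonneg.2 hp.le)
      (ENNReal.inv_ne_top.2 (by simpa using (hc0 i).ne'))
  · rw [← ENNReal.mul_rpow_of_nonneg _ _ (inv_nonneg.2 hp.le), ENNReal.le_rpow_inv_iff hp]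
    calc G i y ^ p = (c i : ℝ≥0∞)⁻¹ * (c i * G i y ^ p) := by
          rw [← mul_assoc, ENNReal.inv_mul_cancel (by simpa using (hc0 i).ne') ENNReal.coe_ne_top,
            one_mul]
      _ ≤ (c i : ℝ≥0∞)⁻¹ * ∑' i, (c i : ℝ≥0∞) * G i y ^ p := by
          gcongr
          exact ENNReal.le_tsum (f := fun i => (c i : ℝ≥0∞) * G i y ^ p) i

end Dominating

section Curves

variable {Y : Type*} [EMetricSpace Y] [MeasurableSpace Y] [BorelSpace Y]
  {X : Type*} [MetricSpace X] {S : Set Y}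

/-- Along a curve which spends almost all of its time in the open set `S` and on which `F` has an
integrable upper gradient, the oscillation of `F` is controlled by any upper gradient of `F` in
`S`. -/
theorem edist_le_setLIntegral_extend_of_isOpen (hS : IsOpen S) {F : Y → X} {G : Y → ℝ≥0∞}
    (hF : IsUpperGradient F G) {v : S → X} {g : S → ℝ≥0∞} (hv : IsUpperGradient v g)
    {γ : ℝ → Y} {a b : ℝ} (hγ : HasUnitSpeedOn γ (Icc a b))
    (hfin : ∫⁻ t in Icc a b, G (γ t) ≠ ⊤)
    (hae : ∀ᵐ t ∂volume.restrict (Icc a b), ∃ h : γ t ∈ S, F (γ t) = v ⟨γ t, h⟩) (hab : a ≤ b) :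
    edist (F (γ a)) (F (γ b)) ≤
      ∫⁻ t in Icc a b, Function.extend Subtype.val g 0 (γ t) := by
  have hk : ∀ s t, a ≤ s → s ≤ t → t ≤ b →
      edist (F (γ s)) (F (γ t)) ≤ ∫⁻ r in Icc s t, G (γ r) := fun s t hs hst ht =>
    hF.edist_le_setLIntegral hst (hγ.mono_Icc hs ht)
  have hcont := hγ.continuousOn
  have hFcont : ContinuousOn (F ∘ γ) (Icc a b) := continuousOn_of_edist_le_setLIntegral hk hfin
  have hgm : Measurable (Function.extend Subtype.val g 0) :=
    (MeasurableEmbedding.subtype_coe hS.measurableSet).measurable_extend hv.1 measurable_const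
  refine edist_le_setLIntegral_of_open (φ := F ∘ γ) (k := G ∘ γ)
    (hS.preimage (continuousOn_iff_continuous_domRestrict.1 hcont))
    (hgm.comp_aemeasurable (hcont.aemeasurable measurableSet_Icc)) ?_ hk hfin ?_ hab
  · rw [ae_restrict_iff' measurableSet_Icc] at hae
    refine measure_mono_null ?_ (ae_iff.1 hae)
    rintro _ ⟨t, ht, rfl⟩ hcon
    exact ht (hcon t.2).1
  · intro s t hst hsub
    have hsS : ∀ r ∈ Icc (s : ℝ) t, γ r ∈ S := fun r hr =>
      hsub (show (⟨r, s.2.1.trans hr.1, hr.2.trans t.2.2⟩ : Icc a b) ∈ Icc s t from hr)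
    have hIcc : Icc (s : ℝ) t ⊆ Icc a b := Icc_subset_Icc s.2.1 t.2.2
    refine edist_le_setLIntegral_of_ae (hFcont.mono hIcc)
      (ae_mono (Measure.restrict_mono hIcc le_rfl) hae) ?_ hst
    rintro r q hr hrq hq ⟨hrS, hr'⟩ ⟨hqS, hq'⟩
    simp only [Function.comp_apply, hr', hq']
    exact hv.edist_le_setLIntegral_extend hrq (hγ.mono_Icc (s.2.1.trans hr) (hq.trans t.2.2))
      (fun x hx => hsS x ⟨hr.trans hx.1, hx.2.trans hq⟩) rfl rfl 0

end Curves

section Kuratowski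

variable {X : Type*} [MetricSpace X] {x : ℕ → X} {y z : X}

theorem edist_le_of_forall_dist_sub_le (hy : y ∈ closure (range x)) {C : ℝ≥0∞}
    (h : ∀ i, edist (dist y (x i)) (dist z (x i)) ≤ C) : edist y z ≤ C := by
  refine ENNReal.le_of_forall_pos_le_add fun ε hε hCtop => ?_
  obtain ⟨_, ⟨i, rfl⟩, hi⟩ := Metric.mem_closure_iff.1 hy (ε / 2) (by positivity)
  have h1 := h i
  lift C to NNReal using hCtop.ne
  rw [edist_dist, Real.dist_eq, ENNReal.ofReal_le_iff_le_toReal (by simp)] at h1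
  rw [edist_dist, ENNReal.ofReal_le_iff_le_toReal (by simp)]
  simp only [ENNReal.coe_toReal, ← ENNReal.coe_add, NNReal.coe_add] at h1 ⊢
  have h2 := (abs_le.1 h1).1
  have h3 := dist_triangle_right y z (x i)
  linarith

theorem MeasureTheory.AEStronglyMeasurable.exists_seq_ae_mem_closure {Y : Type*}
    [MeasurableSpace Y] {μ : Measure Y} [Nonempty X] {f : Y → X} (hf : AEStronglyMeasurable f μ) :
    ∃ x : ℕ → X, ∀ᵐ y ∂μ, f y ∈ closure (range x) := by
  obtain ⟨f₀, hf₀, hff₀⟩ := hf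
  obtain ⟨c, hc, hsub⟩ := hf₀.isSeparable_range
  obtain ⟨x₀⟩ := ‹Nonempty X›
  obtain ⟨x, hx⟩ := (hc.insert x₀).exists_eq_range (insert_nonempty _ _)
  refine ⟨x, hff₀.mono fun y hy => ?_⟩
  rw [hy, ← hx]
  exact closure_mono (subset_insert _ _) (hsub (mem_range_self y))

/-- If almost every point of an interval has the coordinates `φ i t` of a point of the closure of
`range x` and all coordinates are uniformly absolutely continuous, then so does every point. -/
theorem exists_mem_closure_dist_eq [CompleteSpace X] {φ : ℕ → ℝ → ℝ} {k : ℝ → ℝ≥0∞} {a b : ℝ}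
    (hφ : ∀ i s t, a ≤ s → s ≤ t → t ≤ b → edist (φ i s) (φ i t) ≤ ∫⁻ r in Icc s t, k r)
    (hfin : ∫⁻ r in Icc a b, k r ≠ ⊤)
    (hP : ∀ᵐ t ∂volume.restrict (Icc a b), ∃ z ∈ closure (range x), ∀ i, dist z (x i) = φ i t)
    (hab : a < b) {c : ℝ} (hc : c ∈ Icc a b) :
    ∃ z ∈ closure (range x), ∀ i, dist z (x i) = φ i c := by
  have : Nonempty X := ⟨x 0⟩
  set D : Set ℝ := {t | ∃ z ∈ closure (range x), ∀ i, dist z (x i) = φ i t} with hD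
  have hΦ : ∀ t ∈ D, ∃ z : X, z ∈ closure (range x) ∧ ∀ i, dist z (x i) = φ i t := fun t ht => ht
  choose! Φ hΦ1 hΦ2 using hΦ
  have hcD : c ∈ closure (D ∩ Icc a b) := by
    refine Metric.mem_closure_iff.2 fun ε hε => ?_
    rcases hc.2.lt_or_eq with h | h
    · obtain ⟨r, hr, hrD⟩ := exists_mem_Ioo_of_ae hP (s := c) (t := min b (c + ε)) hc.1
        (lt_min h (by linarith)) (min_le_left _ _)
      rw [mem_Ioo, lt_min_iff] at hr
      refine ⟨r, ⟨hrD, hc.1.trans hr.1.le, hr.2.1.le⟩, ?_⟩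
      rw [Real.dist_eq, abs_lt]
      constructor <;> linarith
    · obtain ⟨r, hr, hrD⟩ := exists_mem_Ioo_of_ae hP (s := max a (c - ε)) (t := c)
        (le_max_left _ _) (max_lt (by linarith) (by linarith)) hc.2
      rw [mem_Ioo, max_lt_iff] at hr
      refine ⟨r, ⟨hrD, hr.1.1.le, hr.2.le.trans hc.2⟩, ?_⟩
      rw [Real.dist_eq, abs_lt]
      constructor <;> linarith
  have hne : (nhdsWithin c (D ∩ Icc a b)).NeBot := mem_closure_iff_nhdsWithin_neBot.1 hcD
  have hdist : ∀ s ∈ D ∩ Icc a b, ∀ t ∈ D ∩ Icc a b, s ≤ t →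
      edist (Φ s) (Φ t) ≤ ∫⁻ r in Icc s t, k r := fun s hs t ht hst => by
    refine edist_le_of_forall_dist_sub_le (hΦ1 s hs.1) fun i => ?_
    rw [hΦ2 s hs.1, hΦ2 t ht.1]
    exact hφ i s t hs.2.1 hst ht.2.2
  have hcauchy : Cauchy (Filter.map Φ (nhdsWithin c (D ∩ Icc a b))) := by
    refine EMetric.cauchy_iff.2 ⟨(hne.map Φ).ne, fun ε hε => ?_⟩
    obtain ⟨δ, hδ, H⟩ := exists_pos_setLIntegral_lt_of_measure_lt hfin hε.ne'
    obtain ⟨η, -, hη⟩ := ENNReal.lt_iff_exists_real_btwn.1 hδ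
    have hη0 : 0 < η := ENNReal.ofReal_pos.1 hη.1
    have hlt : ∀ s ∈ Metric.ball c (η / 2) ∩ (D ∩ Icc a b),
        ∀ t ∈ Metric.ball c (η / 2) ∩ (D ∩ Icc a b), s ≤ t → edist (Φ s) (Φ t) < ε := by
      rintro s ⟨hs, hs'⟩ t ⟨ht, ht'⟩ hst
      refine (hdist s hs' t ht' hst).trans_lt ?_
      have hsub : Icc s t ⊆ Icc a b := Icc_subset_Icc hs'.2.1 ht'.2.2
      rw [Metric.mem_ball, Real.dist_eq, abs_lt] at hs ht
      have := H (Icc s t) <| by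
        rw [Measure.restrict_apply measurableSet_Icc, inter_eq_left.2 hsub, Real.volume_Icc]
        exact (ENNReal.ofReal_le_ofReal (by linarith)).trans_lt hη.2
      rwa [Measure.restrict_restrict measurableSet_Icc, inter_eq_left.2 hsub] at this
    refine ⟨Φ '' (Metric.ball c (η / 2) ∩ (D ∩ Icc a b)), Filter.image_mem_map
      (Filter.inter_mem (mem_nhdsWithin_of_mem_nhds (Metric.ball_mem_nhds c (by positivity)))
        self_mem_nhdsWithin), ?_⟩
    rintro _ ⟨s, hs, rfl⟩ _ ⟨t, ht, rfl⟩
    rcases le_total s t with hst | hst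
    · exact hlt s hs t ht hst
    · rw [edist_comm]
      exact hlt t ht s hs hst
  obtain ⟨z, hz⟩ := CompleteSpace.complete hcauchy
  refine ⟨z, isClosed_closure.mem_of_tendsto hz
    (Filter.mem_of_superset self_mem_nhdsWithin fun t ht => hΦ1 t ht.1), fun i => ?_⟩
  have h1 : Filter.Tendsto (φ i) (nhdsWithin c (D ∩ Icc a b)) (nhds (φ i c)) :=
    ((continuousOn_of_edist_le_setLIntegral (hφ i) hfin) c hc).mono_left
      (nhdsWithin_mono c inter_subset_right)
  have hz' : Filter.Tendsto Φ (nhdsWithin c (D ∩ Icc a b)) (nhds z) := hz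
  refine tendsto_nhds_unique ((hz'.dist tendsto_const_nhds).congr' ?_) h1
  exact Filter.mem_of_superset self_mem_nhdsWithin fun t ht => hΦ2 t ht.1 i

end Kuratowski

section Extension

variable {Y : Type*} [EMetricSpace Y] [MeasurableSpace Y] {X : Type*} [MetricSpace X]

theorem edist_dist_sub_dist_sub_le (y z w : X) (c : ℝ) :
    edist (dist y w - c) (dist z w - c) ≤ edist y z := by
  rw [edist_dist, edist_dist, Real.dist_eq, sub_sub_sub_cancel_right]
  exact ENNReal.ofReal_le_ofReal (abs_dist_sub_le y z w)

/-- The coordinates of a Sobolev mapping under the Kuratowski embedding, normalized at the base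
point, are Sobolev functions. -/
theorem MemSobolevBased.dist_sub_dist {μ : Measure Y} {p : ℝ} (hp : 0 ≤ p) {x₀ : X} {f : Y → X}
    (hf : MemSobolevBased μ p x₀ f) (w : X) :
    MemSobolevFun μ p fun y => dist (f y) w - dist x₀ w := by
  obtain ⟨hm, hint, f', hf', g, hg, hgp⟩ := hf
  refine ⟨?_, ?_, fun y => dist (f' y) w - dist x₀ w, ?_, g, ⟨hg.1, fun L γ hL hγ => ?_⟩, hgp⟩
  · exact (hm.dist aestronglyMeasurable_const).sub aestronglyMeasurable_const
  · refine (lintegral_mono fun y => ?_).trans_lt hint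
    refine ENNReal.rpow_le_rpow ?_ hp
    have := edist_dist_sub_dist_sub_le (f y) x₀ w (dist x₀ w)
    rwa [sub_self] at this
  · filter_upwards [hf'] with y hy
    simp only [hy]
  · exact (edist_dist_sub_dist_sub_le _ _ _ _).trans (hg.2 L γ hL hγ)

/-- A Borel function with finite energy whose integral is infinite along each curve which spends
positive time in a given null set or along which one of countably many given functions of finite
energy is not integrable. -/
theorem exists_measurable_rpow_lt_top_forall_curve [BorelSpace Y] {μ : Measure Y} {p : ℝ}
    (hp : 1 ≤ p) {G : ℕ → Y → ℝ≥0∞} (hG : ∀ i, Measurable (G i))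
    (hGp : ∀ i, ∫⁻ y, G i y ^ p ∂μ < ⊤) {N : Set Y} (hN : μ N = 0) :
    ∃ ρ : Y → ℝ≥0∞, Measurable ρ ∧ ∫⁻ y, ρ y ^ p ∂μ < ⊤ ∧
      ∀ (a b : ℝ) (γ : ℝ → Y), ContinuousOn γ (Icc a b) → ∫⁻ t in Icc a b, ρ (γ t) ≠ ⊤ →
        (∀ i, ∫⁻ t in Icc a b, G i (γ t) ≠ ⊤) ∧ ∀ᵐ t ∂volume.restrict (Icc a b), γ t ∉ N := by
  have hp0 : 0 < p := one_pos.trans_le hp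
  obtain ⟨ρ, hρ, hρp, hGρ⟩ := exists_dominating_of_lintegral_rpow_lt_top hp0 hG hGp
  have hTm : MeasurableSet (toMeasurable μ N) := measurableSet_toMeasurable μ N
  have hT0 : μ (toMeasurable μ N) = 0 := by rwa [measure_toMeasurable]
  have hσ : Measurable (ρ + (toMeasurable μ N).indicator ⊤) :=
    hρ.add ((measurable_const (a := (⊤ : ℝ≥0∞))).indicator hTm)
  refine ⟨ρ + (toMeasurable μ N).indicator ⊤, hσ, ?_, fun a b γ hγ hfin => ⟨fun i => ?_, ?_⟩⟩
  · rw [lintegral_congr_ae (g := fun y => ρ y ^ p)]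
    · exact hρp
    · filter_upwards [measure_eq_zero_iff_ae_notMem.1 hT0] with y hy
      simp [hy]
  · obtain ⟨C, hC, hle⟩ := hGρ i
    refine ne_top_of_le_ne_top (ENNReal.mul_ne_top hC hfin) ?_
    rw [← lintegral_const_mul' _ _ hC]
    refine lintegral_mono fun t => (hle (γ t)).trans ?_
    gcongr
    exact le_self_add
  · filter_upwards [ae_lt_top' (hσ.comp_aemeasurable (hγ.aemeasurable measurableSet_Icc)) hfin]
      with t ht hcon
    simp [subset_toMeasurable μ N hcon] at ht

theorem exists_extension_memSobolevBased [BorelSpace Y] [CompleteSpace X] {μ : Measure Y} {p : ℝ}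
    (hp : 1 ≤ p) {E : Set Y} (hE : IsClosed E) (hE0 : μ E = 0)
    (H : ∀ v : (Eᶜ : Set Y) → ℝ, MemSobolevFun (μ.comap Subtype.val) p v →
      ∃ h : Y → ℝ, MemSobolevFun μ p h ∧ ∀ y : (Eᶜ : Set Y), h y = v y)
    {x₀ : X} {f : (Eᶜ : Set Y) → X} (hf : MemSobolevBased (μ.comap Subtype.val) p x₀ f) :
    ∃ h : Y → X, MemSobolevBased μ p x₀ h ∧ ∀ y : (Eᶜ : Set Y), h y = f y := by
  have hp0 : 0 < p := one_pos.trans_le hp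
  have hemb : MeasurableEmbedding (Subtype.val : (Eᶜ : Set Y) → Y) :=
    MeasurableEmbedding.subtype_coe hE.isOpen_compl.measurableSet
  have hmap : (μ.comap (Subtype.val : (Eᶜ : Set Y) → Y)).map Subtype.val = μ := by
    rw [map_comap_subtype_coe hE.isOpen_compl.measurableSet]
    exact Measure.restrict_eq_self_of_ae_mem (measure_eq_zero_iff_ae_notMem.1 hE0)
  have hae : ∀ {P : Y → Prop}, (∀ᵐ y : (Eᶜ : Set Y) ∂μ.comap Subtype.val, P y) →
      ∀ᵐ y ∂μ, P y := fun {P} h => by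
    rw [← hmap]
    exact hemb.ae_map_iff.2 h
  have hlint : ∀ k : Y → ℝ≥0∞,
      ∫⁻ y, k y ∂μ = ∫⁻ y : (Eᶜ : Set Y), k y ∂μ.comap Subtype.val := fun k => by
    conv_lhs => rw [← hmap]
    exact hemb.lintegral_map k
  have : Nonempty X := ⟨x₀⟩
  obtain ⟨x, hx⟩ := hf.1.exists_seq_ae_mem_closure
  choose h hh hhf using fun i => H _ (hf.dist_sub_dist hp0.le (x i))
  choose _ _ F hFh G hFG hGp using hh
  obtain ⟨hfm, hfint, f', hf', g, hg, hgp⟩ := hf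
  have hN : ∀ᵐ y ∂μ, ∃ hy : y ∈ Eᶜ, f' ⟨y, hy⟩ = f ⟨y, hy⟩ ∧ f' ⟨y, hy⟩ ∈ closure (range x) ∧
      ∀ i, F i y = dist (f' ⟨y, hy⟩) (x i) - dist x₀ (x i) := by
    have h1 : ∀ᵐ y ∂μ, ∃ hy : y ∈ Eᶜ, f' ⟨y, hy⟩ = f ⟨y, hy⟩ ∧
        f ⟨y, hy⟩ ∈ closure (range x) := by
      refine hae ?_
      filter_upwards [hf', hx] with y hy hy'
      exact ⟨y.2, hy, hy'⟩
    filter_upwards [h1, ae_all_iff.2 hFh] with y ⟨hy, hyf, hyx⟩ hyF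
    refine ⟨hy, hyf, hyf ▸ hyx, fun i => ?_⟩
    rw [hyF i, hyf, ← hhf i ⟨y, hy⟩]
  obtain ⟨ρ, hρ, hρp, hρc⟩ := exists_measurable_rpow_lt_top_forall_curve hp
    (fun i => (hFG i).1) hGp (ae_iff.1 hN)
  set g₁ : Y → ℝ≥0∞ := Function.extend Subtype.val g 0 with hg₁
  have hg₁m : Measurable g₁ := hemb.measurable_extend hg.1 measurable_const
  have hg₁p : ∫⁻ y, g₁ y ^ p ∂μ < ⊤ := by
    rw [hlint]
    simpa only [hg₁, Subtype.val_injective.extend_apply] using hgp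
  classical
  let P : Y → X → Prop := fun y z =>
    z ∈ closure (range x) ∧ ∀ i, dist z (x i) = F i y + dist x₀ (x i)
  let h' : Y → X := fun y => if hy : ∃ z, P y z then hy.choose else x₀
  have hh' : ∀ y, (∃ z, P y z) → P y (h' y) := fun y hy => by
    simp only [h', dif_pos hy]
    exact hy.choose_spec
  have hval : ∀ y : (Eᶜ : Set Y), Function.extend Subtype.val f (fun _ => x₀) (y : Y) = f y :=
    fun y => Subtype.val_injective.extend_apply f _ y
  refine ⟨Function.extend Subtype.val f fun _ => x₀, ⟨?_, ?_, h', ?_, g₁ + ρ,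
    ⟨hg₁m.add hρ, fun L γ hL hγ => ?_⟩, ?_⟩, hval⟩
  · rw [← hmap, hemb.aestronglyMeasurable_map_iff]
    exact hfm.congr (.of_forall fun y => (hval y).symm)
  · rw [hlint]
    simpa only [hval] using hfint
  · filter_upwards [hN] with y ⟨hy, hyf, hyx, hyF⟩
    have hPy : P y (f' ⟨y, hy⟩) := ⟨hyx, fun i => by rw [hyF i]; ring⟩
    have h2 := hh' y ⟨_, hPy⟩
    have h3 : edist (h' y) (f' ⟨y, hy⟩) ≤ 0 :=
      edist_le_of_forall_dist_sub_le h2.1 fun i => by rw [h2.2 i, hPy.2 i, edist_self]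
    rw [edist_le_zero.1 h3, hyf, ← hval ⟨y, hy⟩]
  · simp only [Pi.add_apply]
    have hcont := hγ.continuousOn
    have hle₁ : ∫⁻ t in Icc 0 L, g₁ (γ t) ≤ ∫⁻ t in Icc 0 L, (g₁ (γ t) + ρ (γ t)) :=
      lintegral_mono fun t => le_self_add
    have hle₂ : ∫⁻ t in Icc 0 L, ρ (γ t) ≤ ∫⁻ t in Icc 0 L, (g₁ (γ t) + ρ (γ t)) :=
      lintegral_mono fun t => le_add_self
    rcases hL.eq_or_lt with rfl | hL'
    · simp
    by_cases htop : ∫⁻ t in Icc 0 L, (g₁ (γ t) + ρ (γ t)) = ⊤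
    · rw [htop]
      exact le_top
    obtain ⟨hGfin, hγN⟩ := hρc 0 L γ hcont (ne_top_of_le_ne_top htop hle₂)
    simp only [mem_ofPred_eq, not_not] at hγN
    have hF : ∀ i s t, 0 ≤ s → s ≤ t → t ≤ L →
        edist (F i (γ s) + dist x₀ (x i)) (F i (γ t) + dist x₀ (x i)) ≤
          ∫⁻ r in Icc s t, g₁ (γ r) := fun i s t hs hst ht => by
      have hsub : Icc s t ⊆ Icc 0 L := Icc_subset_Icc hs ht
      rw [edist_add_right]
      refine edist_le_setLIntegral_extend_of_isOpen hE.isOpen_compl (hFG i)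
        (v := fun y => dist (f' y) (x i) - dist x₀ (x i))
        ⟨hg.1, fun L γ hL hγ => (edist_dist_sub_dist_sub_le _ _ _ _).trans (hg.2 L γ hL hγ)⟩
        (hγ.mono_Icc hs ht) (ne_top_of_le_ne_top (hGfin i) (lintegral_mono_set hsub)) ?_ hst
      filter_upwards [ae_mono (Measure.restrict_mono hsub le_rfl) hγN] with r ⟨hr, _, _, hrF⟩
      exact ⟨hr, hrF i⟩
    have hex : ∀ c ∈ Icc 0 L, ∃ z, P (γ c) z := fun c hc =>
      exists_mem_closure_dist_eq hF (ne_top_of_le_ne_top htop hle₁)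
        (hγN.mono fun t ⟨ht, _, htx, htF⟩ => ⟨_, htx, fun i => by rw [htF i]; ring⟩) hL' hc
    have h0 := hh' _ (hex 0 (left_mem_Icc.2 hL))
    have h1 := hh' _ (hex L (right_mem_Icc.2 hL))
    refine (edist_le_of_forall_dist_sub_le h0.1 fun i => ?_).trans hle₁
    rw [h0.2 i, h1.2 i]
    exact hF i 0 L le_rfl hL le_rfl
  · exact ENNReal.lintegral_rpow_add_lt_top_of_lintegral_rpow_lt_top hg₁m.aemeasurable
      hg₁p hρp hp

end Extension

section Isometry

variable {Y : Type*} [EMetricSpace Y] [MeasurableSpace Y] {X : Type*} [MetricSpace X]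
  {X' : Type*} [MetricSpace X']

theorem Isometry.memSobolevBased_comp {μ : Measure Y} {p : ℝ} {x₀ : X} {f : Y → X} {e : X → X'}
    (he : Isometry e) (hf : MemSobolevBased μ p x₀ f) :
    MemSobolevBased μ p (e x₀) (e ∘ f) := by
  obtain ⟨hm, hint, f', hf', g, hg, hgp⟩ := hf
  refine ⟨he.continuous.comp_aestronglyMeasurable hm, ?_, e ∘ f', ?_, g,
    ⟨hg.1, fun L γ hL hγ => ?_⟩, hgp⟩
  · simpa only [Function.comp_apply, he.edist_eq] using hint
  · filter_upwards [hf'] with y hy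
    simp only [Function.comp_apply, hy]
  · simpa only [Function.comp_apply, he.edist_eq] using hg.2 L γ hL hγ

end Isometry

theorem isometry_up : Isometry (ULift.up.{v} : ℝ → ULift.{v} ℝ) := fun _ _ => rfl

theorem isometry_down : Isometry (ULift.down : ULift.{v} ℝ → ℝ) := fun _ _ => rfl

theorem IsRemovableForMappings.isRemovableForFunctions {M : Type u} [EMetricSpace M]
    [MeasurableSpace M] [BorelSpace M] {n : ℕ} {p : ℝ} {E : Set M} (hE : IsClosed E)
    (h : IsRemovableForMappings.{u, v} n p E) : IsRemovableForFunctions n p E := by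
  refine ⟨h.1, fun f hf => ?_⟩
  obtain ⟨k, ⟨x₀, hk⟩, hkf⟩ := h.2 (ULift.{v} ℝ) (ULift.up ∘ f)
    ⟨_, isometry_up.memSobolevBased_comp hf⟩
  have hdown := isometry_down.memSobolevBased_comp hk
  have hkf' : ∀ y : (Eᶜ : Set M), (ULift.down ∘ k) y = f y := fun y => by
    simp only [Function.comp_apply, hkf y]
  refine ⟨ULift.down ∘ k, ⟨hdown.1, ?_, hdown.2.2⟩, hkf'⟩
  have h0 : ∀ᵐ y ∂(Measure.euclideanHausdorffMeasure n : Measure M), y ∈ Eᶜ :=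
    measure_eq_zero_iff_ae_notMem.1 h.1
  rw [← Measure.restrict_eq_self_of_ae_mem h0,
    ← lintegral_subtype_comap hE.isOpen_compl.measurableSet]
  simp only [hkf']
  exact hf.2.1

theorem proposition3p2 (p : ℝ) (hp : 1 ≤ p) (n : ℕ)
    {M : Type u} [EMetricSpace M] [SecondCountableTopology M]
    [MeasurableSpace M] [BorelSpace M]
    [ChartedSpace (EuclideanSpace ℝ (Fin n)) M] [IsManifold (𝓡 n) ∞ M]
    [RiemannianBundle (fun x : M ↦ TangentSpace (𝓡 n) x)]
    [IsContMDiffRiemannianBundle (𝓡 n) ∞ (EuclideanSpace ℝ (Fin n))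
      (fun x : M ↦ TangentSpace (𝓡 n) x)]
    [IsRiemannianManifold (𝓡 n) M]
    (E : Set M) (hE : IsClosed E) :
    IsRemovableForFunctions n p E ↔ IsRemovableForMappings.{u, v} n p E := by
  constructor
  · rintro ⟨hE0, H⟩
    refine ⟨hE0, fun X _ _ f ⟨x₀, hf⟩ => ?_⟩
    obtain ⟨h, hh, hhf⟩ := exists_extension_memSobolevBased hp hE hE0 H hf
    exact ⟨h, ⟨x₀, hh⟩, hhf⟩
  · exact fun h => h.isRemovableForFunctions hE
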